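/- Fix a continuous Riemannian metric on $\mathbb{T}^3=\mathbb{R}^3/\mathbb{Z}^3$, with norm $\|\cdot\|$ on tangent vectors, and let $f:\mathbb{T}^3\to\mathbb{T}^3$ be a $C^2$ diffeomorphism that is (absolutely) partially hyperbolic: there are a $Df$-invariant splitting $T\mathbb{T}^3=E^s\oplus E^c\oplus E^u$ into one-dimensional bundles and constants $C>0$ and $0<\nu_-\le\nu_+<\mu_-\le 1\le\mu_+<\lambda_-\le\lambda_+$ such that for all $x\in\mathbb{T}^3$ and all integers $n\ge 0$ $$\tfrac1C\nu_-^n\|v\|\le\|Df^n(x)v\|\le C\nu_+^n\|v\|\quad (v\in E^s(x)),$$ $$\tfrac1C\mu_-^n\|v\|\le\|Df^n(x)v\|\le C\mu_+^n\|v\|\quad (v\in E^c(x)),$$ $$\tfrac1C\lambda_-^n\|v\|\le\|Df^n(x)v\|\le C\lambda_+^n\|v\|\quad (v\in E^u(x)).$$ For $\sigma\in\{s,u\}$ let $J^\sigma f(x)=\|Df(x)|_{E^\sigma(x)}\|$ and, whenever the product (the limit of its partial products) converges, put $$\Delta^u(x,y)=\prod_{i=1}^{\infty}\frac{J^uf(f^{-i}(x))}{J^uf(f^{-i}(y))},\qquad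 \Delta^s(x,y)=\prod_{i=0}^{\infty}\frac{J^sf(f^{i}(x))}{J^sf(f^{i}(y))}.$$ Let $\sigma\in\{s,u\}$, and suppose that there are a dense subset $D\subset\mathbb{T}^3$ and a constant $K>1$ such that for all $y_1,y_2\in D$ and all integers $n\ge 0$ the product $\Delta^\sigma(f^n(y_1),f^n(y_2))$ converges and $$K^{-1}\le\Delta^\sigma(f^n(y_1),f^n(y_2))\le K .$$ Then all periodic points of $f$ have the same Lyapunov exponent in the $E^\sigma$-direction: there is $\lambda\in\mathbb{R}$ such that $\lim_{n\to\infty}\frac1n\log\|Df^n(p)v\|=\lambda$ for every periodic point $p$ of $f$ and every $0\ne v\in E^\sigma(p)$. -/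

import Mathlib

open Filter Topology

noncomputable section

namespace PHTorus

/-- The tangent space of the three-torus at any of its points (the torus is parallelised by its
translations). -/
abbrev V : Type := Fin 3 → ℝ

/-- The three-torus `ℝ³ / ℤ³`. -/
abbrev T3 : Type := UnitAddTorus (Fin 3)

/-- The quotient map `ℝ³ → ℝ³ / ℤ³`. -/
def proj (v : V) : T3 := fun i => (v i : UnitAddCircle)

/-- The representative of a point of the torus in the cube `(-1/2, 1/2]³`; it is a section of
`proj`, and inverts `proj` near `0`. -/
def rep (x : T3) : V := fun i => (AddCircle.equivIoc (1 : ℝ) (-1 / 2) (x i) : ℝ)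

/-- The expression of `f` near `p` in the charts `v ↦ p + proj v` at `p` and
`w ↦ f p + proj w` at `f p`; it sends `0` to `0`. -/
def inCharts (f : T3 → T3) (p : T3) (v : V) : V := rep (f (p + proj v) - f p)

/-- `f` is of class `C²`. -/
def IsC2 (f : T3 → T3) : Prop := ∀ p, ContDiffAt ℝ 2 (inCharts f p) 0

/-- `f` is a `C²` diffeomorphism. -/
def IsC2Diffeo (f : T3 ≃ T3) : Prop := IsC2 f ∧ IsC2 f.symm

/-- The derivative `Df(p) : T_p 𝕋³ → T_{f p} 𝕋³`. -/
def D (f : T3 → T3) (p : T3) : V →L[ℝ] V := fderiv ℝ (inCharts f p) 0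

/-- A continuous Riemannian metric on the torus. -/
structure RiemannianMetric where
  inner : T3 → V →L[ℝ] V →L[ℝ] ℝ
  continuous_inner : Continuous inner
  symm : ∀ p v w, inner p v w = inner p w v
  pos : ∀ p v, v ≠ 0 → 0 < inner p v v

/-- The length of the tangent vector `v` at `p`. -/
def RiemannianMetric.norm (g : RiemannianMetric) (p : T3) (v : V) : ℝ :=
  Real.sqrt (g.inner p v v)

/-- The labels of the three invariant bundles: stable, central, unstable. -/
inductive Label : Type
  | s
  | c
  | u
  deriving DecidableEq

/-- `T𝕋³ = E^s ⊕ E^c ⊕ E^u` is an absolutely partially hyperbolic splitting for `f` into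
line bundles. -/
structure IsPartiallyHyperbolicSplitting (g : RiemannianMetric) (f : T3 → T3)
    (E : Label → T3 → Submodule ℝ V) : Prop where
  finrank_eq_one : ∀ τ p, Module.finrank ℝ (E τ p) = 1
  isInternal : ∀ p, DirectSum.IsInternal fun τ => E τ p
  map_eq : ∀ τ p, (E τ p).map (D f p).toLinearMap = E τ (f p)
  exists_rates : ∃ C ν₁ ν₂ μ₁ μ₂ l₁ l₂ : ℝ,
    0 < C ∧ 0 < ν₁ ∧ ν₁ ≤ ν₂ ∧ ν₂ < μ₁ ∧ μ₁ ≤ 1 ∧ 1 ≤ μ₂ ∧ μ₂ < l₁ ∧ l₁ ≤ l₂ ∧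
    ∀ (n : ℕ) (p : T3),
      (∀ v ∈ E Label.s p, 1 / C * ν₁ ^ n * g.norm p v ≤ g.norm (f^[n] p) (D f^[n] p v) ∧
        g.norm (f^[n] p) (D f^[n] p v) ≤ C * ν₂ ^ n * g.norm p v) ∧
      (∀ v ∈ E Label.c p, 1 / C * μ₁ ^ n * g.norm p v ≤ g.norm (f^[n] p) (D f^[n] p v) ∧
        g.norm (f^[n] p) (D f^[n] p v) ≤ C * μ₂ ^ n * g.norm p v) ∧
      (∀ v ∈ E Label.u p, 1 / C * l₁ ^ n * g.norm p v ≤ g.norm (f^[n] p) (D f^[n] p v) ∧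
        g.norm (f^[n] p) (D f^[n] p v) ≤ C * l₂ ^ n * g.norm p v)

/-- The Jacobian of `f` at `p` along the line `L`: the norm of `Df(p)|L`. -/
def jacobian (g : RiemannianMetric) (f : T3 → T3) (L : T3 → Submodule ℝ V) (p : T3) : ℝ :=
  sSup {r : ℝ | ∃ v ∈ L p, g.norm p v = 1 ∧ r = g.norm (f p) (D f p v)}

/-- `Δ^s(x, y) = d`: the product `∏_{i ≥ 0} J^s f(f^i x) / J^s f(f^i y)` converges to `d`. -/
def HasDeltaS (g : RiemannianMetric) (f : T3 ≃ T3) (L : T3 → Submodule ℝ V) (x y : T3)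
    (d : ℝ) : Prop :=
  Tendsto (fun N : ℕ => ∏ i ∈ Finset.range N,
    jacobian g f L (f^[i] x) / jacobian g f L (f^[i] y)) atTop (𝓝 d)

/-- `Δ^u(x, y) = d`: the product `∏_{i ≥ 1} J^u f(f^{-i} x) / J^u f(f^{-i} y)` converges
to `d`. -/
def HasDeltaU (g : RiemannianMetric) (f : T3 ≃ T3) (L : T3 → Submodule ℝ V) (x y : T3)
    (d : ℝ) : Prop :=
  Tendsto (fun N : ℕ => ∏ i ∈ Finset.Icc 1 N,
    jacobian g f L (f.symm^[i] x) / jacobian g f L (f.symm^[i] y)) atTop (𝓝 d)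

/-- `Δ^σ(x, y) = d`; on the central bundle the formula of the unstable one is used. -/
def HasDelta (g : RiemannianMetric) (f : T3 ≃ T3) (E : Label → T3 → Submodule ℝ V) :
    Label → T3 → T3 → ℝ → Prop
  | Label.s => HasDeltaS g f (E Label.s)
  | Label.c => HasDeltaU g f (E Label.c)
  | Label.u => HasDeltaU g f (E Label.u)

/-- The Lyapunov exponent of `f` at `p` along the line `L` exists and equals `l`. -/
def HasLyapunovExponent (g : RiemannianMetric) (f : T3 → T3) (L : T3 → Submodule ℝ V) (p : T3)
    (l : ℝ) : Prop :=
  ∀ v ∈ L p, v ≠ 0 →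
    Tendsto (fun n : ℕ => 1 / (n : ℝ) * Real.log (g.norm (f^[n] p) (D f^[n] p v))) atTop (𝓝 l)

end PHTorus

end

/-!
On `E^τ` the growth rates of `Df^n` lie in an interval `[a τ, b τ]` and the three intervals are
disjoint, so `E^τ` consists of the vectors growing at rate at most `b τ` forwards and at most
`(a τ)⁻¹` backwards. These are closed conditions, whence the bundles, and with them the Jacobians,
are continuous.

The cocycle relations `Δ^u(f^n x, f^n y) = (J^u f^n(x) / J^u f^n(y)) Δ^u(x, y)` and
`Δ^s(x, y) = (J^s f^n(x) / J^s f^n(y)) Δ^s(f^n x, f^n y)` bound `J^σ f^n(x) / J^σ f^n(y)` by `K ^ 2`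
for `x`, `y` in the dense set, and by continuity for all `x`, `y`. Thus the Birkhoff sums of
`log J^σ f` depend on the starting point only up to a bounded error; by Fekete's lemma their
averages converge, and the limit is the same at all points.
-/

open Asymptotics

namespace PHTorus

/-! ### Charts and derivatives -/

theorem proj_add (v w : V) : proj (v + w) = proj v + proj w := rfl

theorem proj_sub (v w : V) : proj (v - w) = proj v - proj w := rfl

theorem proj_rep (x : T3) : proj (rep x) = x :=
  funext fun _ => AddCircle.coe_equivIoc

theorem rep_proj {v : V} (hv : ‖v‖ < 1 / 2) : rep (proj v) = v := by
  funext i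
  have hi := abs_lt.1 ((norm_le_pi_norm v i).trans_lt hv)
  exact AddCircle.equivIoc_coe_of_mem ⟨by linarith [hi.1], by linarith [hi.2]⟩

theorem rep_zero : rep 0 = 0 :=
  rep_proj (v := 0) (by norm_num)

theorem rep_sub {x y : T3} (hx : ‖rep x‖ < 1 / 4) (hy : ‖rep y‖ < 1 / 4) :
    rep (x - y) = rep x - rep y := by
  have hxy : ‖rep x - rep y‖ < 1 / 2 := by linarith [norm_sub_le (rep x) (rep y)]
  rw [← rep_proj hxy, proj_sub, proj_rep, proj_rep]

theorem continuous_proj : Continuous proj :=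
  continuous_pi fun i => (AddCircle.continuous_mk' 1).comp (continuous_apply i)

theorem continuousAt_rep_zero : ContinuousAt rep 0 := by
  refine continuousAt_pi.2 fun i => ?_
  have zero_ne_cut : ((0 : ℝ) : UnitAddCircle) ≠ ((-1 / 2 : ℝ) : UnitAddCircle) := by
    rw [Ne, AddCircle.coe_eq_coe_iff_of_mem_Ico (a := -1 / 2) ⟨by norm_num, by norm_num⟩
      ⟨by norm_num, by norm_num⟩]
    norm_num
  have hcircle : ContinuousAt (AddCircle.equivIoc (1 : ℝ) (-1 / 2)) ((0 : T3) i) :=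
    AddCircle.continuousAt_equivIoc (1 : ℝ) (-1 / 2) zero_ne_cut
  exact continuousAt_subtype_val.comp
    (hcircle.comp (f := fun x : T3 => x i) (continuous_apply i).continuousAt)

theorem tendsto_rep_sub (p : T3) : Tendsto (fun x => rep (x - p)) (𝓝 p) (𝓝 0) := by
  have hrep : Tendsto rep (𝓝 0) (𝓝 0) := by
    simpa only [rep_zero] using continuousAt_rep_zero.tendsto
  exact hrep.comp (tendsto_sub_nhds_zero_iff.2 tendsto_id)

theorem inCharts_zero (f : T3 → T3) (p : T3) : inCharts f p 0 = 0 := by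
  have hproj : proj 0 = 0 := rfl
  rw [inCharts, hproj, add_zero, sub_self, rep_zero]

theorem add_proj_inCharts (f : T3 → T3) (p : T3) (v : V) :
    f p + proj (inCharts f p v) = f (p + proj v) := by
  rw [inCharts, proj_rep, add_sub_cancel]

theorem inCharts_comp (f h : T3 → T3) (p : T3) :
    inCharts (f ∘ h) p = inCharts f (h p) ∘ inCharts h p := by
  funext v
  simp only [Function.comp_apply, inCharts.eq_def f, add_proj_inCharts]
  rfl

theorem inCharts_id (p : T3) : inCharts id p =ᶠ[𝓝 0] id := by
  filter_upwards [Metric.ball_mem_nhds (0 : V) one_half_pos] with v hv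
  simp only [inCharts, id_eq, add_sub_cancel_left, rep_proj (mem_ball_zero_iff.1 hv)]

theorem D_id (p : T3) : D id p = ContinuousLinearMap.id ℝ V := by
  rw [D, (inCharts_id p).fderiv_eq, fderiv_id]

theorem D_comp {f h : T3 → T3} {p : T3} (hf : DifferentiableAt ℝ (inCharts f (h p)) 0)
    (hh : DifferentiableAt ℝ (inCharts h p) 0) : D (f ∘ h) p = (D f (h p)).comp (D h p) := by
  rw [← inCharts_zero h p] at hf
  rw [D, inCharts_comp, fderiv_comp 0 hf hh, inCharts_zero]
  rfl

theorem continuousAt_of_continuousAt_inCharts {f : T3 → T3} {p : T3}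
    (hf : ContinuousAt (inCharts f p) 0) : ContinuousAt f p := by
  have f_eq : f = fun x => f p + proj (inCharts f p (rep (x - p))) := by
    funext x
    rw [add_proj_inCharts, proj_rep, add_sub_cancel]
  have hcharts : Tendsto (fun x => inCharts f p (rep (x - p))) (𝓝 p) (𝓝 0) := by
    simpa only [inCharts_zero] using! hf.tendsto.comp (tendsto_rep_sub p)
  have hproj : Tendsto (fun x => f p + proj (inCharts f p (rep (x - p)))) (𝓝 p)
      (𝓝 (f p + proj 0)) :=
    ((continuous_proj.tendsto 0).comp hcharts).const_add (f p)
  rw [ContinuousAt]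
  convert hproj using 2
  exact (add_zero (f p)).symm

theorem inCharts_add_proj {f : T3 → T3} {p : T3} {v w : V} (hv : ‖inCharts f p v‖ < 1 / 4)
    (hvw : ‖inCharts f p (v + w)‖ < 1 / 4) :
    inCharts f (p + proj v) w = inCharts f p (v + w) - inCharts f p v := by
  simp only [inCharts] at hv hvw ⊢
  rw [← rep_sub hvw hv, proj_add, add_assoc, sub_sub_sub_cancel_right]

theorem eventually_D_eq_fderiv_inCharts {f : T3 → T3} {p : T3}
    (hf : ContinuousAt (inCharts f p) 0) :
    ∀ᶠ x in 𝓝 p, D f x = fderiv ℝ (inCharts f p) (rep (x - p)) := by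
  have hsmall : ∀ᶠ v in 𝓝 (0 : V), ‖inCharts f p v‖ < 1 / 4 :=
    hf.norm.eventually_lt_const (by simp [inCharts_zero])
  filter_upwards [(tendsto_rep_sub p).eventually hsmall.eventually_nhds] with x hx
  set v := rep (x - p) with hv
  have hxv : x = p + proj v := by rw [hv, proj_rep, add_sub_cancel]
  have hshift : Tendsto (fun w : V => v + w) (𝓝 0) (𝓝 v) := by
    simpa using (continuous_const_add v).tendsto 0
  have hev : inCharts f x =ᶠ[𝓝 0] fun w => inCharts f p (v + w) - inCharts f p v := by
    filter_upwards [hshift.eventually hx] with w hw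
    rw [hxv, inCharts_add_proj hx.self_of_nhds hw]
  rw [D, hev.fderiv_eq, fderiv_sub_const, fderiv_comp_add_left, add_zero]

/-! ### Maps of class `C¹` -/

/-- `f` is of class `C¹`; as for `IsC2`, the condition at the centre of each chart is a condition
on a neighbourhood of it. -/
def IsC1 (f : T3 → T3) : Prop := ∀ p, ContDiffAt ℝ 1 (inCharts f p) 0

/-- `f` is a `C¹` diffeomorphism. -/
def IsC1Diffeo (f : T3 ≃ T3) : Prop := IsC1 f ∧ IsC1 f.symm

theorem IsC2.isC1 {f : T3 → T3} (hf : IsC2 f) : IsC1 f := fun p => (hf p).of_le one_le_two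

theorem IsC2Diffeo.isC1Diffeo {f : T3 ≃ T3} (hf : IsC2Diffeo f) : IsC1Diffeo f :=
  ⟨hf.1.isC1, hf.2.isC1⟩

namespace IsC1

variable {f h : T3 → T3}

theorem differentiableAt (hf : IsC1 f) (p : T3) : DifferentiableAt ℝ (inCharts f p) 0 :=
  (hf p).differentiableAt one_ne_zero

theorem continuous (hf : IsC1 f) : Continuous f :=
  continuous_iff_continuousAt.2 fun p => continuousAt_of_continuousAt_inCharts (hf p).continuousAt

theorem continuous_D (hf : IsC1 f) : Continuous (D f) := by
  refine continuous_iff_continuousAt.2 fun p => ?_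
  have hfderiv : ContinuousAt (fderiv ℝ (inCharts f p)) (rep (p - p)) := by
    rw [sub_self, rep_zero]
    exact ((hf p).fderiv_right (m := 0) (by norm_num)).continuousAt
  have hrep : ContinuousAt (fun x => rep (x - p)) p := by
    simpa only [ContinuousAt, sub_self, rep_zero] using tendsto_rep_sub p
  exact (ContinuousAt.comp (f := fun x => rep (x - p)) hfderiv hrep).congr
    ((eventually_D_eq_fderiv_inCharts (hf p).continuousAt).mono fun _ hx => hx.symm)

theorem id : IsC1 id := fun p => contDiffAt_id.congr_of_eventuallyEq (inCharts_id p)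

theorem comp (hf : IsC1 f) (hh : IsC1 h) : IsC1 (f ∘ h) := by
  intro p
  have hfp := hf (h p)
  rw [← inCharts_zero h p] at hfp
  rw [inCharts_comp]
  exact hfp.comp 0 (hh p)

theorem iterate (hf : IsC1 f) : ∀ n : ℕ, IsC1 f^[n]
  | 0 => IsC1.id
  | n + 1 => (hf.iterate n).comp hf

theorem D_iterate_succ_apply (hf : IsC1 f) (n : ℕ) (p : T3) (v : V) :
    D f^[n + 1] p v = D f (f^[n] p) (D f^[n] p v) := by
  rw [Function.iterate_succ', D_comp (hf.differentiableAt _) ((hf.iterate n).differentiableAt p),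
    ContinuousLinearMap.comp_apply]

theorem leftInverse_D (hf : IsC1 f) (hh : IsC1 h) (hhf : Function.LeftInverse h f) (p : T3) :
    Function.LeftInverse (D h (f p)) (D f p) := fun v => by
  rw [← ContinuousLinearMap.comp_apply, ← D_comp (hh.differentiableAt _) (hf.differentiableAt p),
    hhf.comp_eq_id, D_id, ContinuousLinearMap.id_apply]

theorem D_iterate_mem (hf : IsC1 f) {L : T3 → Submodule ℝ V}
    (hL : ∀ p, ∀ v ∈ L p, D f p v ∈ L (f p)) (n : ℕ) {p : T3} {v : V} (hv : v ∈ L p) :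
    D f^[n] p v ∈ L (f^[n] p) := by
  induction n with
  | zero => simpa [D_id] using hv
  | succ n ih =>
    rw [hf.D_iterate_succ_apply, Function.iterate_succ_apply']
    exact hL _ _ ih

end IsC1

theorem IsC1Diffeo.map_symm_eq {f : T3 ≃ T3} (hf : IsC1Diffeo f) {L : T3 → Submodule ℝ V}
    (hL : ∀ p, (L p).map (D f p).toLinearMap = L (f p)) (p : T3) :
    (L p).map (D f.symm p).toLinearMap = L (f.symm p) := by
  obtain ⟨q, rfl⟩ := f.surjective p
  have hcomp : (D f.symm (f q)).toLinearMap ∘ₗ (D f q).toLinearMap = LinearMap.id :=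
    LinearMap.ext (hf.1.leftInverse_D hf.2 f.left_inv q)
  rw [← hL, ← Submodule.map_comp, hcomp, Submodule.map_id, f.symm_apply_apply]

/-! ### The Riemannian norm -/

namespace RiemannianMetric

variable (g : RiemannianMetric)

theorem norm_nonneg (p : T3) (v : V) : 0 ≤ g.norm p v := Real.sqrt_nonneg _

theorem norm_zero (p : T3) : g.norm p 0 = 0 := by
  rw [norm, map_zero, Real.sqrt_zero]

theorem norm_pos (p : T3) {v : V} (hv : v ≠ 0) : 0 < g.norm p v :=
  Real.sqrt_pos.2 (g.pos p v hv)

theorem norm_smul (p : T3) (c : ℝ) (v : V) : g.norm p (c • v) = |c| * g.norm p v := by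
  simp only [norm, map_smul, smul_apply, smul_eq_mul]
  rw [← mul_assoc, Real.sqrt_mul (mul_self_nonneg c), Real.sqrt_mul_self_eq_abs]

theorem inner_self_nonneg (p : T3) (v : V) : 0 ≤ g.inner p v v := by
  rcases eq_or_ne v 0 with rfl | hv
  · rw [map_zero]
  · exact (g.pos p v hv).le

theorem sq_norm (p : T3) (v : V) : g.norm p v ^ 2 = g.inner p v v :=
  Real.sq_sqrt (g.inner_self_nonneg p v)

theorem inner_le_norm_mul_norm (p : T3) (v w : V) : g.inner p v w ≤ g.norm p v * g.norm p w := by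
  have cauchy_schwarz : g.inner p v w * g.inner p w v ≤ g.inner p v v * g.inner p w w :=
    (g.inner p).toBilinForm.apply_mul_apply_le_of_forall_zero_le (g.inner_self_nonneg p) v w
  refine le_of_sq_le_sq ?_ (mul_nonneg (g.norm_nonneg p v) (g.norm_nonneg p w))
  rw [g.symm p w v] at cauchy_schwarz
  rwa [mul_pow, sq_norm, sq_norm, sq]

theorem norm_add_le (p : T3) (v w : V) : g.norm p (v + w) ≤ g.norm p v + g.norm p w := by
  refine Real.sqrt_le_iff.2 ⟨add_nonneg (g.norm_nonneg p v) (g.norm_nonneg p w), ?_⟩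
  calc g.inner p (v + w) (v + w)
      = g.norm p v ^ 2 + 2 * g.inner p v w + g.norm p w ^ 2 := by
        simp only [map_add, add_apply, sq_norm, g.symm p w v]
        ring
    _ ≤ g.norm p v ^ 2 + 2 * (g.norm p v * g.norm p w) + g.norm p w ^ 2 := by
        gcongr
        exact g.inner_le_norm_mul_norm p v w
    _ = (g.norm p v + g.norm p w) ^ 2 := by ring

theorem continuous_norm : Continuous fun x : T3 × V => g.norm x.1 x.2 := by
  have := g.continuous_inner
  unfold norm
  fun_prop

end RiemannianMetric

/-! ### Continuity of dominated splittings -/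

section SlowSubspace

variable {g : RiemannianMetric} {f : T3 → T3} {p : T3} {v : V}

/-- The tangent vectors `v` at `p` for which `Df^n v` grows strictly slower than `r ^ n`. -/
def slowSubspace (g : RiemannianMetric) (f : T3 → T3) (r : ℝ) (p : T3) : Submodule ℝ V where
  carrier := {v | (fun n : ℕ => g.norm (f^[n] p) (D f^[n] p v)) =o[atTop] fun n => r ^ n}
  zero_mem' := by
    simpa only [Set.mem_ofPred_eq, map_zero, g.norm_zero] using isLittleO_zero _ _
  add_mem' {v w} hv hw := by
    refine (isBigO_of_le _ fun n => ?_).trans_isLittleO (hv.add hw)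
    rw [map_add, Real.norm_of_nonneg (g.norm_nonneg _ _), Real.norm_eq_abs]
    exact (g.norm_add_le _ _ _).trans (le_abs_self _)
  smul_mem' c v hv := by
    simpa only [Set.mem_ofPred_eq, map_smul, g.norm_smul] using hv.const_mul_left |c|

theorem mem_slowSubspace {r : ℝ} : v ∈ slowSubspace g f r p ↔
    (fun n : ℕ => g.norm (f^[n] p) (D f^[n] p v)) =o[atTop] fun n => r ^ n :=
  Iff.rfl

theorem slowSubspace_mono {r s : ℝ} (hr : 0 ≤ r) (hrs : r ≤ s) :
    slowSubspace g f r p ≤ slowSubspace g f s p := fun _ hv =>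
  mem_slowSubspace.2 <| (mem_slowSubspace.1 hv).trans_isBigO <| isBigO_of_le _ fun n => by
    rw [Real.norm_of_nonneg (pow_nonneg hr n), Real.norm_of_nonneg (pow_nonneg (hr.trans hrs) n)]
    exact pow_le_pow_left₀ hr hrs n

theorem mem_slowSubspace_of_norm_le {b r C : ℝ} (hb : 0 ≤ b) (hbr : b < r)
    (hv : ∀ n : ℕ, g.norm (f^[n] p) (D f^[n] p v) ≤ C * (b ^ n * g.norm p v)) :
    v ∈ slowSubspace g f r p := by
  have hO : (fun n : ℕ => g.norm (f^[n] p) (D f^[n] p v)) =O[atTop] fun n => b ^ n := by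
    refine IsBigO.of_bound (C * g.norm p v) (Eventually.of_forall fun n => ?_)
    rw [Real.norm_of_nonneg (g.norm_nonneg _ _), Real.norm_of_nonneg (pow_nonneg hb n), mul_assoc,
      mul_comm (g.norm p v)]
    exact hv n
  exact mem_slowSubspace.2 (hO.trans_isLittleO (isLittleO_pow_pow_of_lt_left hb hbr))

theorem eq_zero_of_mem_slowSubspace {a C : ℝ} (ha : 0 < a)
    (hle : ∀ n : ℕ, a ^ n * g.norm p v ≤ C * g.norm (f^[n] p) (D f^[n] p v))
    (hv : v ∈ slowSubspace g f a p) : v = 0 := by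
  by_contra hv0
  have hO : (fun n : ℕ => a ^ n) =O[atTop] fun n => g.norm (f^[n] p) (D f^[n] p v) := by
    refine IsBigO.of_bound (C / g.norm p v) (Eventually.of_forall fun n => ?_)
    rw [Real.norm_of_nonneg (g.norm_nonneg _ _), Real.norm_of_nonneg (pow_nonneg ha.le n),
      div_mul_eq_mul_div, le_div_iff₀ (g.norm_pos p hv0)]
    exact hle n
  exact isLittleO_irrefl (Frequently.of_forall fun n => (pow_pos ha n).ne')
    (hO.trans_isLittleO (mem_slowSubspace.1 hv))

end SlowSubspace

/-- An absolutely dominated splitting of `T𝕋³`: the growth rates of `Df^n` on the invariant bundle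
`E i` lie in `[a i, b i]`, uniformly up to the constant `C`, and these intervals are disjoint. -/
structure IsDominatedSplitting {ι : Type*} (g : RiemannianMetric) (f : T3 → T3)
    (E : ι → T3 → Submodule ℝ V) (a b : ι → ℝ) (C : ℝ) : Prop where
  iSup_eq_top : ∀ p, ⨆ i, E i p = ⊤
  map_eq : ∀ i p, (E i p).map (D f p).toLinearMap = E i (f p)
  pos : ∀ i, 0 < a i
  le : ∀ i, a i ≤ b i
  lt_or_lt : Pairwise fun i j => b i < a j ∨ b j < a i
  le_norm : ∀ i (n : ℕ) p, ∀ v ∈ E i p, a i ^ n * g.norm p v ≤ C * g.norm (f^[n] p) (D f^[n] p v)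
  norm_le : ∀ i (n : ℕ) p, ∀ v ∈ E i p,
    g.norm (f^[n] p) (D f^[n] p v) ≤ C * (b i ^ n * g.norm p v)

namespace IsDominatedSplitting

variable {ι : Type*} {g : RiemannianMetric} {E : ι → T3 → Submodule ℝ V} {a b : ι → ℝ} {C : ℝ}

theorem symm {f : T3 ≃ T3} (hE : IsDominatedSplitting g f E a b C) (hf : IsC1Diffeo f) :
    IsDominatedSplitting g f.symm E b⁻¹ a⁻¹ C := by
  have hmap : ∀ i p, (E i p).map (D f.symm p).toLinearMap = E i (f.symm p) := fun i =>
    hf.map_symm_eq (hE.map_eq i)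
  have hmem : ∀ i (n : ℕ) {p v}, v ∈ E i p → D f.symm^[n] p v ∈ E i (f.symm^[n] p) :=
    fun i n _ _ => hf.2.D_iterate_mem
      (fun p v hv => hmap i p ▸ Submodule.mem_map_of_mem hv) n
  have hinv (n : ℕ) : Function.LeftInverse f^[n] f.symm^[n] :=
    Function.LeftInverse.iterate f.right_inv n
  have hD (n : ℕ) (p : T3) (v : V) : D f^[n] (f.symm^[n] p) (D f.symm^[n] p v) = v :=
    (hf.2.iterate n).leftInverse_D (hf.1.iterate n) (hinv n) p v
  have hb (i : ι) : 0 < b i := (hE.pos i).trans_le (hE.le i)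
  refine ⟨hE.iSup_eq_top, hmap, fun i => inv_pos.2 (hb i),
    fun i => inv_anti₀ (hE.pos i) (hE.le i),
    fun i j hij => (hE.lt_or_lt hij).symm.imp (inv_strictAnti₀ (hb j)) (inv_strictAnti₀ (hb i)),
    fun i n p v hv => ?_, fun i n p v hv => ?_⟩
  · have h := hE.norm_le i n _ _ (hmem i n hv)
    rw [hinv n p, hD] at h
    rw [Pi.inv_apply, inv_pow, inv_mul_le_iff₀ (pow_pos (hb i) n), mul_left_comm]
    exact h
  · have h := hE.le_norm i n _ _ (hmem i n hv)
    rw [hinv n p, hD] at h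
    rw [Pi.inv_apply, inv_pow, mul_left_comm, ← div_eq_inv_mul, le_div_iff₀' (pow_pos (hE.pos i) n)]
    exact h

theorem exists_sum_eq [Fintype ι] {f : T3 → T3} (hE : IsDominatedSplitting g f E a b C)
    (p : T3) (v : V) : ∃ w : ι → V, (∀ i, w i ∈ E i p) ∧ ∑ i, w i = v := by
  have hv : v ∈ ⨆ i ∈ Finset.univ, E i p := by
    simp only [Finset.mem_univ, iSup_pos, hE.iSup_eq_top, Submodule.mem_top]
  obtain ⟨w, hw⟩ := (Submodule.mem_iSup_finset_iff_exists_sum (fun i => E i p) v).1 hv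
  exact ⟨fun i => w i, fun i => (w i).2, hw⟩

theorem eq_zero_of_sum_mem_slowSubspace [Fintype ι] {f : T3 → T3}
    (hE : IsDominatedSplitting g f E a b C) {p : T3} {w : ι → V} (hw : ∀ i, w i ∈ E i p) {j : ι}
    (hsum : ∑ i, w i ∈ slowSubspace g f (a j) p) : w j = 0 := by
  classical
  by_contra hj
  -- The fastest nonvanishing component is the sum minus slower components, hence slow itself.
  obtain ⟨k, hk, hmax⟩ := Finset.exists_max_image {i | w i ≠ 0 ∧ a j ≤ a i} a
    ⟨j, Finset.mem_filter_univ _ |>.2 ⟨hj, le_rfl⟩⟩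
  obtain ⟨hk0, hjk⟩ := (Finset.mem_filter_univ _).1 hk
  have slow_of_ne : ∀ i ≠ k, w i ∈ slowSubspace g f (a k) p := by
    intro i hik
    rcases eq_or_ne (w i) 0 with hi0 | hi0
    · exact hi0 ▸ zero_mem _
    have hba : b i < a k := (hE.lt_or_lt hik).resolve_right fun hki => by
      have hlt : a k < a i := (hE.le k).trans_lt hki
      exact hlt.not_ge (hmax i ((Finset.mem_filter_univ _).2 ⟨hi0, hjk.trans hlt.le⟩))
    exact mem_slowSubspace_of_norm_le ((hE.pos i).le.trans (hE.le i)) hba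
      fun n => hE.norm_le i n p _ (hw i)
  have slow_k : w k ∈ slowSubspace g f (a k) p := by
    rw [← add_sub_cancel_right (w k) (∑ i ∈ Finset.univ.erase k, w i),
      Finset.add_sum_erase _ _ (Finset.mem_univ k)]
    exact sub_mem (slowSubspace_mono (hE.pos j).le hjk hsum)
      (sum_mem fun i hi => slow_of_ne i (Finset.ne_of_mem_erase hi))
  exact hk0 (eq_zero_of_mem_slowSubspace (hE.pos k) (fun n => hE.le_norm k n p _ (hw k)) slow_k)

theorem mem_iff [Finite ι] {f : T3 ≃ T3} (hE : IsDominatedSplitting g f E a b C)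
    (hf : IsC1Diffeo f) {i : ι} {p : T3} {v : V} : v ∈ E i p ↔
      (∀ n : ℕ, g.norm (f^[n] p) (D f^[n] p v) ≤ C * (b i ^ n * g.norm p v)) ∧
      ∀ n : ℕ, g.norm (f.symm^[n] p) (D f.symm^[n] p v) ≤ C * ((a i)⁻¹ ^ n * g.norm p v) := by
  cases nonempty_fintype ι
  have hE' := hE.symm hf
  refine ⟨fun hv => ⟨fun n => hE.norm_le i n p v hv, fun n => hE'.norm_le i n p v hv⟩, ?_⟩
  rintro ⟨hfwd, hbwd⟩
  obtain ⟨w, hw, rfl⟩ := hE.exists_sum_eq p v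
  have hzero : ∀ j ≠ i, w j = 0 := by
    intro j hji
    rcases hE.lt_or_lt hji with hlt | hlt
    · exact hE'.eq_zero_of_sum_mem_slowSubspace hw <| mem_slowSubspace_of_norm_le
        (inv_pos.2 (hE.pos i)).le (inv_strictAnti₀ ((hE.pos j).trans_le (hE.le j)) hlt) hbwd
    · exact hE.eq_zero_of_sum_mem_slowSubspace hw <| mem_slowSubspace_of_norm_le
        ((hE.pos i).le.trans (hE.le i)) hlt hfwd
  rw [Fintype.sum_eq_single i hzero]
  exact hw i

theorem isClosed [Finite ι] {f : T3 ≃ T3} (hE : IsDominatedSplitting g f E a b C)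
    (hf : IsC1Diffeo f) (i : ι) : IsClosed {x : T3 × V | x.2 ∈ E i x.1} := by
  have isClosed_rate {h : T3 → T3} (hh : IsC1 h) (r : ℝ) : IsClosed {x : T3 × V |
      ∀ n : ℕ, g.norm (h^[n] x.1) (D h^[n] x.1 x.2) ≤ C * (r ^ n * g.norm x.1 x.2)} := by
    simp only [Set.ofPred_forall]
    refine isClosed_iInter fun n => isClosed_le ?_ ?_
    · have hc := (hh.iterate n).continuous
      have hD := (hh.iterate n).continuous_D
      exact g.continuous_norm.comp (f := fun x : T3 × V => (h^[n] x.1, D h^[n] x.1 x.2))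
        (by fun_prop)
    · exact continuous_const.mul (continuous_const.mul g.continuous_norm)
  simp only [hE.mem_iff hf]
  exact (isClosed_rate hf.1 (b i)).inter (isClosed_rate hf.2 (a i)⁻¹)

end IsDominatedSplitting

instance : Finite Label :=
  Set.finite_univ_iff.1 <| (Set.toFinite {Label.s, Label.c, Label.u}).subset <| by
    rintro (_ | _ | _) - <;> simp

theorem IsPartiallyHyperbolicSplitting.exists_isDominatedSplitting {g : RiemannianMetric}
    {f : T3 → T3} {E : Label → T3 → Submodule ℝ V} (hE : IsPartiallyHyperbolicSplitting g f E) :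
    ∃ a b C, IsDominatedSplitting g f E a b C := by
  obtain ⟨C, ν₁, ν₂, μ₁, μ₂, l₁, l₂, hC, hν₁, hν, hνμ, hμ₁, hμ₂, hμl, hl, H⟩ := hE.exists_rates
  have lower {r x y : ℝ} (h : 1 / C * r * x ≤ y) : r * x ≤ C * y := by
    rwa [mul_assoc, one_div, inv_mul_le_iff₀ hC] at h
  have upper {r x y : ℝ} (h : y ≤ C * r * x) : y ≤ C * (r * x) := by rwa [← mul_assoc]
  refine ⟨fun | .s => ν₁ | .c => μ₁ | .u => l₁, fun | .s => ν₂ | .c => μ₂ | .u => l₂, C,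
    fun p => (hE.isInternal p).submodule_iSup_eq_top, hE.map_eq, ?_, ?_, ?_, ?_, ?_⟩
  · rintro (_ | _ | _) <;> dsimp only <;> linarith
  · rintro (_ | _ | _) <;> dsimp only <;> linarith
  · rintro (_ | _ | _) (_ | _ | _) hij
    · exact absurd rfl hij
    · exact .inl (by dsimp only; linarith)
    · exact .inl (by dsimp only; linarith)
    · exact .inr (by dsimp only; linarith)
    · exact absurd rfl hij
    · exact .inl (by dsimp only; linarith)
    · exact .inr (by dsimp only; linarith)
    · exact .inr (by dsimp only; linarith)
    · exact absurd rfl hij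
  · rintro (_ | _ | _) n p v hv
    exacts [lower ((H n p).1 v hv).1, lower ((H n p).2.1 v hv).1, lower ((H n p).2.2 v hv).1]
  · rintro (_ | _ | _) n p v hv
    exacts [upper ((H n p).1 v hv).2, upper ((H n p).2.1 v hv).2, upper ((H n p).2.2 v hv).2]

/-! ### The Jacobian along a line bundle -/

/-- The unit sphere bundle of a field of subspaces `L`. -/
def unitBundle {X E : Type*} [NormedAddCommGroup E] [NormedSpace ℝ E] (L : X → Submodule ℝ E) :
    Set (X × Metric.sphere (0 : E) 1) :=
  {x | (x.2 : E) ∈ L x.1}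

theorem isQuotientMap_unitBundle_fst {X E : Type*} [TopologicalSpace X] [NormedAddCommGroup E]
    [NormedSpace ℝ E] [ProperSpace E] {L : X → Submodule ℝ E} (hL : ∀ p, Nontrivial (L p))
    (hcl : IsClosed {x : X × E | x.2 ∈ L x.1}) :
    IsQuotientMap fun x : unitBundle L => x.1.1 := by
  have hclosed : IsClosed (unitBundle L) :=
    hcl.preimage (f := fun x : X × Metric.sphere (0 : E) 1 => (x.1, (x.2 : E))) (by fun_prop)
  refine (isClosedMap_fst_of_compactSpace.comp
    hclosed.isClosedEmbedding_subtypeVal.isClosedMap).isQuotientMap (by fun_prop) fun p => ?_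
  have := hL p
  obtain ⟨v, hv⟩ := exists_norm_eq (L p) zero_le_one
  exact ⟨⟨(p, ⟨v, mem_sphere_zero_iff_norm.2 hv⟩), v.2⟩, rfl⟩

section Jacobian

variable {g : RiemannianMetric} {f h : T3 → T3} {L : T3 → Submodule ℝ V} {p : T3}

theorem jacobian_eq_div (hL : Module.finrank ℝ (L p) = 1) {v : V} (hv : v ∈ L p) (hv0 : v ≠ 0) :
    jacobian g f L p = g.norm (f p) (D f p v) / g.norm p v := by
  have hpos := g.norm_pos p hv0
  have eq_singleton : {r : ℝ | ∃ w ∈ L p, g.norm p w = 1 ∧ r = g.norm (f p) (D f p w)} =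
      {g.norm (f p) (D f p v) / g.norm p v} := by
    ext r
    simp only [Set.mem_ofPred_eq, Set.mem_singleton_iff]
    constructor
    · rintro ⟨w, hw, hw1, rfl⟩
      obtain ⟨c, hc⟩ := exists_smul_eq_of_finrank_eq_one hL (x := (⟨v, hv⟩ : L p))
        (by simpa using hv0) ⟨w, hw⟩
      obtain rfl : c • v = w := congrArg Subtype.val hc
      rw [g.norm_smul] at hw1
      rw [map_smul, g.norm_smul, eq_div_iff hpos.ne', mul_right_comm, hw1, one_mul]
    · rintro rfl
      refine ⟨(g.norm p v)⁻¹ • v, (L p).smul_mem _ hv, ?_, ?_⟩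
      · rw [g.norm_smul, abs_of_pos (inv_pos.2 hpos), inv_mul_cancel₀ hpos.ne']
      · rw [map_smul, g.norm_smul, abs_of_pos (inv_pos.2 hpos), div_eq_inv_mul]
  rw [jacobian, eq_singleton, csSup_singleton]

theorem norm_D_apply (hL : Module.finrank ℝ (L p) = 1) {v : V} (hv : v ∈ L p) :
    g.norm (f p) (D f p v) = jacobian g f L p * g.norm p v := by
  rcases eq_or_ne v 0 with rfl | hv0
  · rw [map_zero, g.norm_zero, g.norm_zero, mul_zero]
  · rw [jacobian_eq_div hL hv hv0, div_mul_cancel₀ _ (g.norm_pos p hv0).ne']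

theorem exists_mem_ne_zero (hL : Module.finrank ℝ (L p) = 1) : ∃ v ∈ L p, v ≠ 0 :=
  (L p).exists_mem_ne_zero_of_ne_bot (Submodule.one_le_finrank_iff.1 hL.ge)

theorem jacobian_pos (hL : Module.finrank ℝ (L p) = 1) (hD : Function.Injective (D f p)) :
    0 < jacobian g f L p := by
  obtain ⟨v, hv, hv0⟩ := exists_mem_ne_zero hL
  rw [jacobian_eq_div hL hv hv0]
  exact div_pos (g.norm_pos _ ((map_ne_zero_iff _ hD).2 hv0)) (g.norm_pos p hv0)

theorem jacobian_id (hL : Module.finrank ℝ (L p) = 1) : jacobian g id L p = 1 := by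
  obtain ⟨v, hv, hv0⟩ := exists_mem_ne_zero hL
  rw [jacobian_eq_div hL hv hv0, D_id]
  exact div_self (g.norm_pos p hv0).ne'

theorem jacobian_comp (hf : DifferentiableAt ℝ (inCharts f (h p)) 0)
    (hh : DifferentiableAt ℝ (inCharts h p) 0) (hLp : Module.finrank ℝ (L p) = 1)
    (hLh : Module.finrank ℝ (L (h p)) = 1) (hmap : ∀ v ∈ L p, D h p v ∈ L (h p)) :
    jacobian g (f ∘ h) L p = jacobian g f L (h p) * jacobian g h L p := by
  obtain ⟨v, hv, hv0⟩ := exists_mem_ne_zero hLp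
  refine mul_right_cancel₀ (g.norm_pos p hv0).ne' ?_
  rw [mul_assoc, ← norm_D_apply hLp hv, ← norm_D_apply hLp hv, ← norm_D_apply hLh (hmap v hv),
    D_comp hf hh]
  rfl

theorem IsC1.jacobian_iterate (hf : IsC1 f) (hL : ∀ p, Module.finrank ℝ (L p) = 1)
    (hmap : ∀ p, ∀ v ∈ L p, D f p v ∈ L (f p)) (n : ℕ) (p : T3) :
    jacobian g f^[n] L p = ∏ i ∈ Finset.range n, jacobian g f L (f^[i] p) := by
  induction n with
  | zero => exact jacobian_id (hL p)
  | succ n ih =>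
    rw [Function.iterate_succ', jacobian_comp (hf.differentiableAt _)
      ((hf.iterate n).differentiableAt p) (hL _) (hL _) fun v => hf.D_iterate_mem hmap n, ih,
      Finset.prod_range_succ, mul_comm]

theorem IsC1.continuous_jacobian (hf : IsC1 f) (hL : ∀ p, Module.finrank ℝ (L p) = 1)
    (hcl : IsClosed {x : T3 × V | x.2 ∈ L x.1}) : Continuous (jacobian g f L) := by
  have hquot := isQuotientMap_unitBundle_fst
    (fun p => Module.nontrivial_of_finrank_pos (R := ℝ) (hL p ▸ one_pos)) hcl
  have hne (x : unitBundle L) : (x.1.2 : V) ≠ 0 := ne_zero_of_mem_unit_sphere x.1.2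
  have heq : jacobian g f L ∘ (fun x : unitBundle L => x.1.1) = fun x =>
      g.norm (f x.1.1) (D f x.1.1 x.1.2) / g.norm x.1.1 x.1.2 :=
    funext fun x => jacobian_eq_div (hL _) x.2 (hne x)
  have hc := hf.continuous
  have hD := hf.continuous_D
  rw [hquot.continuous_iff, heq]
  refine Continuous.div ?_ ?_ fun x => (g.norm_pos _ (hne x)).ne'
  · exact g.continuous_norm.comp
      (f := fun x : unitBundle L => (f x.1.1, D f x.1.1 (x.1.2 : V))) (by fun_prop)
  · exact g.continuous_norm.comp (f := fun x : unitBundle L => (x.1.1, (x.1.2 : V))) (by fun_prop)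

end Jacobian

/-! ### Birkhoff sums with bounded oscillation -/

section Birkhoff

variable {X : Type*} {F : X → X} {φ : X → ℝ} {c : ℝ}

theorem subadditive_birkhoffSum_add (h : ∀ n x y, birkhoffSum F φ n x ≤ birkhoffSum F φ n y + c)
    (x : X) : Subadditive fun n => birkhoffSum F φ n x + c := fun m n => by
  simp only [birkhoffSum_add]
  linarith [h n (F^[m] x) x]

theorem mul_le_birkhoffSum (h : ∀ x y, φ x ≤ φ y + c) (n : ℕ) (x : X) :
    n * (φ x - c) ≤ birkhoffSum F φ n x := by
  have hsum := Finset.card_nsmul_le_sum (Finset.range n) (fun i => φ (F^[i] x)) (φ x - c)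
    fun i _ => sub_le_iff_le_add.2 (h x (F^[i] x))
  rwa [Finset.card_range, nsmul_eq_mul] at hsum

theorem exists_tendsto_birkhoffAverage
    (h : ∀ n x y, birkhoffSum F φ n x ≤ birkhoffSum F φ n y + c) :
    ∃ l : ℝ, ∀ x, Tendsto (fun n => birkhoffAverage ℝ F φ n x) atTop (𝓝 l) := by
  rcases isEmpty_or_nonempty X with hX | ⟨⟨x₀⟩⟩
  · exact ⟨0, hX.elim⟩
  have hsub := subadditive_birkhoffSum_add h x₀
  have hc : 0 ≤ c := by simpa using h 0 x₀ x₀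
  have bddBelow : BddBelow (Set.range fun n : ℕ => (birkhoffSum F φ n x₀ + c) / n) := by
    refine ⟨min 0 (φ x₀ - c), Set.forall_mem_range.2 fun n => ?_⟩
    rcases n.eq_zero_or_pos with rfl | hn
    · simp
    · have hlow := mul_le_birkhoffSum (F := F) (fun x y => by simpa using h 1 x y) n x₀
      refine (min_le_right _ _).trans ?_
      rw [le_div_iff₀' (Nat.cast_pos.2 hn)]
      linarith
  refine ⟨hsub.lim, fun x => ?_⟩
  have tendsto_error : Tendsto
      (fun n : ℕ => (birkhoffSum F φ n x - birkhoffSum F φ n x₀ - c) / (n : ℝ)) atTop (𝓝 0) := by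
    refine squeeze_zero_norm (fun n => ?_) (tendsto_const_div_atTop_nhds_zero_nat (2 * c))
    rw [norm_div, Real.norm_natCast, Real.norm_eq_abs]
    gcongr
    rw [abs_le]
    constructor <;> linarith [h n x x₀, h n x₀ x]
  refine (add_zero hsub.lim ▸ (hsub.tendsto_lim bddBelow).add tendsto_error).congr fun n => ?_
  rw [birkhoffAverage, smul_eq_mul]
  ring

end Birkhoff

/-! ### The cocycle relations of the products `Δ` -/

section Delta

variable {α M : Type*} [CommMonoid M]

theorem prod_Icc_symm_apply (f : Equiv.Perm α) (J : α → M) (n : ℕ) (x : α) :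
    ∏ i ∈ Finset.Icc 1 (n + 1), J (f.symm^[i] (f x)) =
      J x * ∏ i ∈ Finset.Icc 1 n, J (f.symm^[i] x) := by
  induction n with
  | zero => simp
  | succ n ih =>
    rw [Finset.prod_Icc_succ_top (by lia), ih, Finset.prod_Icc_succ_top (by lia), mul_assoc,
      Function.iterate_succ_apply f.symm (n + 1), Equiv.symm_apply_apply]

theorem prod_Icc_symm_iterate (f : Equiv.Perm α) (J : α → M) (n N : ℕ) (x : α) :
    ∏ i ∈ Finset.Icc 1 (N + n), J (f.symm^[i] (f^[n] x)) =
      (∏ i ∈ Finset.range n, J (f^[i] x)) * ∏ i ∈ Finset.Icc 1 N, J (f.symm^[i] x) := by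
  induction n with
  | zero => simp
  | succ n ih =>
    rw [← add_assoc, Function.iterate_succ_apply', prod_Icc_symm_apply, ih,
      Finset.prod_range_succ, ← mul_assoc, mul_comm (J _)]

variable {g : RiemannianMetric} {f : T3 ≃ T3} {L : T3 → Submodule ℝ V} {x y : T3} {n : ℕ}

theorem HasDeltaU.iterate {d : ℝ} (h : HasDeltaU g f L x y d) (n : ℕ) :
    HasDeltaU g f L (f^[n] x) (f^[n] y)
      ((∏ i ∈ Finset.range n, jacobian g f L (f^[i] x)) /
        (∏ i ∈ Finset.range n, jacobian g f L (f^[i] y)) * d) := by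
  unfold HasDeltaU at h ⊢
  rw [← tendsto_add_atTop_iff_nat n]
  refine (h.const_mul _).congr fun N => ?_
  simp only [Finset.prod_div_distrib]
  rw [prod_Icc_symm_iterate, prod_Icc_symm_iterate, mul_div_mul_comm]

theorem HasDeltaS.of_iterate {d : ℝ} (h : HasDeltaS g f L (f^[n] x) (f^[n] y) d) :
    HasDeltaS g f L x y
      ((∏ i ∈ Finset.range n, jacobian g f L (f^[i] x)) /
        (∏ i ∈ Finset.range n, jacobian g f L (f^[i] y)) * d) := by
  unfold HasDeltaS at h ⊢
  rw [← tendsto_add_atTop_iff_nat n]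
  refine (h.const_mul _).congr fun N => ?_
  rw [add_comm N n, Finset.prod_range_add]
  simp only [Finset.prod_div_distrib, ← Function.iterate_add_apply, add_comm]

variable {E : Label → T3 → Submodule ℝ V} {σ : Label}

theorem HasDelta.cocycle {d₀ d : ℝ} (h₀ : HasDelta g f E σ x y d₀)
    (h : HasDelta g f E σ (f^[n] x) (f^[n] y) d) :
    (∏ i ∈ Finset.range n, jacobian g f (E σ) (f^[i] x)) /
        (∏ i ∈ Finset.range n, jacobian g f (E σ) (f^[i] y)) * d₀ = d ∨
      (∏ i ∈ Finset.range n, jacobian g f (E σ) (f^[i] x)) /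
        (∏ i ∈ Finset.range n, jacobian g f (E σ) (f^[i] y)) * d = d₀ :=
  match σ with
  | .s => .inr (tendsto_nhds_unique (HasDeltaS.of_iterate h) h₀)
  | .c | .u => .inl (tendsto_nhds_unique (HasDeltaU.iterate h₀ n) h)

theorem HasDelta.prod_jacobian_div_le {K d₀ d : ℝ} (hK : 0 < K)
    (h₀ : HasDelta g f E σ x y d₀) (hd₀ : d₀ ∈ Set.Icc K⁻¹ K)
    (h : HasDelta g f E σ (f^[n] x) (f^[n] y) d) (hd : d ∈ Set.Icc K⁻¹ K) :
    (∏ i ∈ Finset.range n, jacobian g f (E σ) (f^[i] x)) /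
      (∏ i ∈ Finset.range n, jacobian g f (E σ) (f^[i] y)) ≤ K ^ 2 := by
  have le_sq {r d d' : ℝ} (hr : r * d = d') (hd : d ∈ Set.Icc K⁻¹ K) (hd' : d' ∈ Set.Icc K⁻¹ K) :
      r ≤ K ^ 2 := by
    have hinv : 0 < K⁻¹ := inv_pos.2 hK
    calc r = d' / d := eq_div_of_mul_eq (hinv.trans_le hd.1).ne' hr
      _ ≤ K / K⁻¹ := div_le_div₀ hK.le hd'.2 hinv hd.1
      _ = K ^ 2 := by rw [div_inv_eq_mul, sq]
  rcases h₀.cocycle h with hr | hr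
  exacts [le_sq hr hd₀ hd, le_sq hr hd hd₀]

end Delta

/-! ### Lyapunov exponents -/

section Lyapunov

variable {g : RiemannianMetric} {f : T3 → T3} {L : T3 → Submodule ℝ V} {K : ℝ}

theorem exists_hasLyapunovExponent (hf : IsC1 f) (hD : ∀ p, Function.Injective (D f p))
    (hL : ∀ p, Module.finrank ℝ (L p) = 1) (hmap : ∀ p, ∀ v ∈ L p, D f p v ∈ L (f p))
    (hK : 0 < K) (h : ∀ (n : ℕ) x y, jacobian g f^[n] L x ≤ K * jacobian g f^[n] L y) :
    ∃ l : ℝ, ∀ p, HasLyapunovExponent g f L p l := by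
  have jacobian_ne_zero (p : T3) : jacobian g f L p ≠ 0 := (jacobian_pos (hL p) (hD p)).ne'
  have iterate_pos (n : ℕ) (p : T3) : 0 < jacobian g f^[n] L p := by
    rw [hf.jacobian_iterate hL hmap]
    exact Finset.prod_pos fun i _ => jacobian_pos (hL _) (hD _)
  have log_iterate (n : ℕ) (p : T3) : Real.log (jacobian g f^[n] L p) =
      birkhoffSum f (fun x => Real.log (jacobian g f L x)) n p := by
    rw [hf.jacobian_iterate hL hmap, Real.log_prod fun i _ => jacobian_ne_zero _, birkhoffSum]
  obtain ⟨l, hl⟩ := exists_tendsto_birkhoffAverage (F := f)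
      (φ := fun x => Real.log (jacobian g f L x)) (c := Real.log K) fun n x y => by
    rw [← log_iterate, ← log_iterate, add_comm, ← Real.log_mul hK.ne' (iterate_pos n y).ne']
    exact Real.log_le_log (iterate_pos n x) (h n x y)
  refine ⟨l, fun p v hv hv0 => ?_⟩
  have hlim := (hl p).add (tendsto_const_div_atTop_nhds_zero_nat (Real.log (g.norm p v)))
  refine (add_zero l ▸ hlim).congr fun n => ?_
  rw [norm_D_apply (hL p) hv, Real.log_mul (iterate_pos n p).ne' (g.norm_pos p hv0).ne',
    log_iterate, birkhoffAverage, smul_eq_mul]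
  ring

end Lyapunov

theorem le_mul_of_dense {X : Type*} [TopologicalSpace X] {S : Set X} (hS : Dense S) {J : X → ℝ}
    (hJ : Continuous J) {K : ℝ} (h : ∀ x ∈ S, ∀ y ∈ S, J x ≤ K * J y) (x y : X) :
    J x ≤ K * J y := by
  have hclosed : IsClosed {z : X × X | J z.1 ≤ K * J z.2} :=
    isClosed_le (by fun_prop) (by fun_prop)
  exact hclosed.closure_subset_iff.2 (fun z hz => h _ hz.1 _ hz.2) ((hS.prod hS) (x, y))

end PHTorus

theorem proposition4p4_general (g : PHTorus.RiemannianMetric) (f : PHTorus.T3 ≃ PHTorus.T3)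
    (hf : PHTorus.IsC1Diffeo f)
    (E : PHTorus.Label → PHTorus.T3 → Submodule ℝ PHTorus.V)
    (hE : PHTorus.IsPartiallyHyperbolicSplitting g f E)
    (σ : PHTorus.Label) (S : Set PHTorus.T3) (hS : Dense S)
    (hΔ : ∃ K : ℝ, 0 < K ∧ ∀ y₁ ∈ S, ∀ y₂ ∈ S, ∀ n : ℕ,
      ∃ d : ℝ, PHTorus.HasDelta g f E σ (f^[n] y₁) (f^[n] y₂) d ∧ K⁻¹ ≤ d ∧ d ≤ K) :
    ∃ l : ℝ, ∀ p, PHTorus.HasLyapunovExponent g f (E σ) p l := by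
  obtain ⟨K, hK, H⟩ := hΔ
  obtain ⟨a, b, C, hdom⟩ := hE.exists_isDominatedSplitting
  have hL := hE.finrank_eq_one σ
  have hmap (p) (v) (hv : v ∈ E σ p) : PHTorus.D f p v ∈ E σ (f p) :=
    hE.map_eq σ p ▸ Submodule.mem_map_of_mem hv
  have hD (p) : Function.Injective (PHTorus.D f p) :=
    (hf.1.leftInverse_D hf.2 f.left_inv p).injective
  refine PHTorus.exists_hasLyapunovExponent hf.1 hD hL hmap (pow_pos hK 2) fun n =>
    PHTorus.le_mul_of_dense hS ((hf.1.iterate n).continuous_jacobian hL (hdom.isClosed hf σ)) ?_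
  intro x hx y hy
  obtain ⟨d₀, h₀, hd₀⟩ := H x hx y hy 0
  obtain ⟨d, h, hd⟩ := H x hx y hy n
  rw [hf.1.jacobian_iterate hL hmap, hf.1.jacobian_iterate hL hmap, ← div_le_iff₀
    (Finset.prod_pos fun i _ => PHTorus.jacobian_pos (hL _) (hD _))]
  exact h₀.prod_jacobian_div_le hK hd₀ h hd

theorem proposition4p4 (g : PHTorus.RiemannianMetric) (f : PHTorus.T3 ≃ PHTorus.T3)
    (hf : PHTorus.IsC2Diffeo f)
    (E : PHTorus.Label → PHTorus.T3 → Submodule ℝ PHTorus.V)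
    (hE : PHTorus.IsPartiallyHyperbolicSplitting g f E)
    (σ : PHTorus.Label) (hσ : σ = PHTorus.Label.s ∨ σ = PHTorus.Label.u)
    (S : Set PHTorus.T3) (hS : Dense S)
    (hΔ : ∃ K : ℝ, 1 < K ∧ ∀ y₁ ∈ S, ∀ y₂ ∈ S, ∀ n : ℕ,
      ∃ d : ℝ, PHTorus.HasDelta g f E σ (f^[n] y₁) (f^[n] y₂) d ∧ K⁻¹ ≤ d ∧ d ≤ K) :
    ∃ l : ℝ, ∀ p ∈ Function.periodicPts f, PHTorus.HasLyapunovExponent g f (E σ) p l := by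
  obtain ⟨K, hK, H⟩ := hΔ
  obtain ⟨l, hl⟩ := proposition4p4_general g f hf.isC1Diffeo E hE σ S hS ⟨K, one_pos.trans hK, H⟩
  exact ⟨l, fun p _ => hl p⟩
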